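/- Let $\mathbb{K}=\mathbb{Q}(\sqrt{-m})\subset\mathbb{C}$ ($m\in\mathbb{N}$ squarefree) be an imaginary-quadratic number field with ring of integers $\mathcal{O}_{\mathbb{K}}$ and discriminant $d_{\mathbb{K}}$, and let $n\ge 1$. Let $SU(n,n;\mathbb{C})$ be the group of all $M\in SL_{2n}(\mathbb{C})$ with $\overline{M}^{tr}JM=J$, where $J=\begin{pmatrix}0&-I\\ I&0\end{pmatrix}$ and $I$ is the $n\times n$ identity matrix. For $L\in\mathcal{O}_{\mathbb{K}}^{2n\times 2n}$ let $\mathcal{I}(L)\subseteq\mathcal{O}_{\mathbb{K}}$ be the ideal generated by the entries of $L$, and let $$\Delta^*_{n,\mathbb{K}}=\left\{\tfrac1u L\in SU(n,n;\mathbb{C})\;:\;L\in\mathcal{O}_{\mathbb{K}}^{2n\times 2n},\ u\in\mathbb{C}\setminus\{0\},\ u^n\in\mathcal{O}_{\mathbb{K}},\ u^n\mathcal{O}_{\mathbb{K}}=\mathcal{I}(L)^n\right\}$$ be the extended Hermitian modular group of degree $n$. Let $$\widehat{\mathbb{K}}_n=\mathbb{Q}\left(m_{i,j}\;:\;M=(m_{i,j})\in\Delta^*_{n,\mathbb{K}},\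 1\le i,j\le 2n\right)\subseteq\mathbb{C}$$ be the field generated over $\mathbb{Q}$ by all entries of all elements of $\Delta^*_{n,\mathbb{K}}$. Then $\widehat{\mathbb{K}}_n$ is a number field, and the extension $\widehat{\mathbb{K}}_n\supseteq\mathbb{Q}$ is unramified outside of $n\,d_{\mathbb{K}}$, i.e. every prime number $p$ not dividing $n\,d_{\mathbb{K}}$ is unramified in $\widehat{\mathbb{K}}_n$. -/

import Mathlib

open scoped NumberField Matrix

noncomputable section

/-- The special unitary group `SU(n,n;ℂ)`: the complex `2n × 2n` matrices `M`, written in `n × n`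
blocks, with `det M = 1` and `M̄ᵗʳ J M = J`, where `J = (0, -I; I, 0)`. -/
def specialUnitary (n : ℕ) : Subgroup (Matrix.SpecialLinearGroup (Fin n ⊕ Fin n) ℂ) where
  carrier := {M | (M : Matrix (Fin n ⊕ Fin n) (Fin n ⊕ Fin n) ℂ)ᴴ * Matrix.J (Fin n) ℂ *
    (M : Matrix (Fin n ⊕ Fin n) (Fin n ⊕ Fin n) ℂ) = Matrix.J (Fin n) ℂ}
  one_mem' := by simp
  mul_mem' := by
    intro M N hM hN
    simp only [Set.mem_ofPred_eq, Matrix.SpecialLinearGroup.coe_mul,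
      Matrix.conjTranspose_mul] at hM hN ⊢
    calc _ = (N : Matrix (Fin n ⊕ Fin n) (Fin n ⊕ Fin n) ℂ)ᴴ *
          ((M : Matrix (Fin n ⊕ Fin n) (Fin n ⊕ Fin n) ℂ)ᴴ * Matrix.J (Fin n) ℂ * M.1) * N.1 := by
            simp only [Matrix.mul_assoc]
      _ = _ := by rw [hM, hN]
  inv_mem' := by
    intro M hM
    simp only [Set.mem_ofPred_eq] at hM ⊢
    have h : M.1 * (M⁻¹).1 = 1 := by
      rw [← Matrix.SpecialLinearGroup.coe_mul, mul_inv_cancel, Matrix.SpecialLinearGroup.coe_one]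
    have h' : (M⁻¹).1ᴴ * M.1ᴴ = 1 := by
      rw [← Matrix.conjTranspose_mul, h, Matrix.conjTranspose_one]
    calc (M⁻¹).1ᴴ * Matrix.J (Fin n) ℂ * (M⁻¹).1
        = (M⁻¹).1ᴴ * (M.1ᴴ * Matrix.J (Fin n) ℂ * M.1) * (M⁻¹).1 := by rw [hM]
      _ = ((M⁻¹).1ᴴ * M.1ᴴ) * Matrix.J (Fin n) ℂ * (M.1 * (M⁻¹).1) := by
            simp only [Matrix.mul_assoc]
      _ = _ := by rw [h, h', one_mul, mul_one]

/-- The ideal `I(L)` generated by the entries of the matrix `L`. -/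
def entryIdeal {ι R : Type*} [CommRing R] (L : Matrix ι ι R) : Ideal R :=
  Ideal.span {x | ∃ i j, L i j = x}

/-- The extended Hermitian modular group `Δ*_{n,K}` of degree `n`: all `M ∈ SU(n,n;ℂ)` of the form
`(1/u) L` with `L` a `2n × 2n` matrix over `𝓞 K` and `u ∈ ℂ`, `u ≠ 0`, such that
`u ^ n ∈ 𝓞 K` and `u ^ n 𝓞 K = I(L) ^ n`. -/
def extendedHermitianModularGroup (K : IntermediateField ℚ ℂ) (n : ℕ) :
    Set (Matrix.SpecialLinearGroup (Fin n ⊕ Fin n) ℂ) :=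
  {M | M ∈ specialUnitary n ∧
    ∃ (u : ℂ) (L : Matrix (Fin n ⊕ Fin n) (Fin n ⊕ Fin n) (𝓞 K)), u ≠ 0 ∧
      (∀ i j, M i j = u⁻¹ * ((L i j : K) : ℂ)) ∧
      ∃ a : 𝓞 K, ((a : K) : ℂ) = u ^ n ∧ Ideal.span {a} = entryIdeal L ^ n}

/-- The field of definition `K̂_n = ℚ(m_{ij} ; M = (m_{ij}) ∈ Δ*_{n,K}) ⊆ ℂ`. -/
def fieldOfDefinition (K : IntermediateField ℚ ℂ) (n : ℕ) : IntermediateField ℚ ℂ :=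
  IntermediateField.adjoin ℚ {z | ∃ M ∈ extendedHermitianModularGroup K n, ∃ i j, M i j = z}

end

/-! Entries of elements of `Δ*` are `u⁻¹` times elements of `K`, so the field of definition lies in
the field `F` generated by `K` and all `u ≠ 0` with `(u ^ n) = I ^ n`. It suffices to treat `F`.
Finiteness: up to factors in `K` and `n`-th roots of units, `u` depends only on the class of `I`;
class group and unit group are finite (`exists_eq_mul_of_mk0_eq`). Normality: embeddings of `F`
permute the generators. Ramification: let `σ` be in the inertia group at `P ∣ p`, `p ∤ n d_K`. It
fixes `K`. Scaling `u` by `K` makes it integral and prime to `P`; then `σ u` and `u` are congruent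
mod `P` with equal `n`-th powers, hence equal as `n ∉ P` (`root_fixed_of_mem_inertia`). So inertia
is trivial. -/

/-! ### Inertia groups and `n`-th roots -/

theorem card_inertia_eq_ramificationIdx {F : Type*} [Field F] [NumberField F] [IsGalois ℚ F]
    {p : ℕ} (hp : p.Prime) (P : Ideal (𝓞 F)) [P.IsPrime] [P.LiesOver (Ideal.span {(p : ℤ)})] :
    Nat.card (P.inertia Gal(F/ℚ)) = P.ramificationIdx ℤ := by
  have hp0 : Ideal.span {(p : ℤ)} ≠ ⊥ := by simpa using hp.ne_zero
  have hpp : (Ideal.span {(p : ℤ)}).IsPrime :=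
    (Ideal.span_singleton_prime (by simpa using hp.ne_zero)).2 (Nat.prime_iff_prime_int.1 hp)
  have : Finite (ℤ ⧸ Ideal.span {(p : ℤ)}) := Ring.HasFiniteQuotients.finiteQuotient hp0
  have := hpp.isMaximal hp0
  rw [Ideal.card_inertia_eq_ramificationIdxIn (Ideal.span {(p : ℤ)}) P,
    Ideal.ramificationIdxIn_eq_ramificationIdx (Ideal.span {(p : ℤ)}) P Gal(F/ℚ)]

theorem ramificationIdx_eq_one_iff_isUnramifiedAt {F : Type*} [Field F] [NumberField F]
    (P : Ideal (𝓞 F)) [P.IsPrime] :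
    P.ramificationIdx ℤ = 1 ↔ Algebra.IsUnramifiedAt ℤ P :=
  Ideal.ramificationIdx_eq_one_iff

/-- An element of the inertia group at a prime over `p` fixes every normal subfield in which `p`
is unramified. -/
theorem algebraMap_fixed_of_mem_inertia {K F : Type*} [Field K] [Field F] [NumberField K]
    [NumberField F] [Algebra K F] [IsGalois ℚ K] {p : ℕ} (hp : p.Prime)
    (hK : ¬ (p : ℤ) ∣ NumberField.discr K) (P : Ideal (𝓞 F)) [P.IsPrime]
    [hP : P.LiesOver (Ideal.span {(p : ℤ)})] {σ : Gal(F/ℚ)}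
    (hσ : σ ∈ P.inertia Gal(F/ℚ)) (x : K) : σ (algebraMap K F x) = algebraMap K F x := by
  let Q : Ideal (𝓞 K) := P.under (𝓞 K)
  have : Q.LiesOver (Ideal.span {(p : ℤ)}) := ⟨by
    rw [hP.over]; exact (Ideal.under_under P).symm⟩
  have hunr := (NumberField.not_dvd_discr_iff_isUnramifiedIn K (𝓞 K)
    (Nat.prime_iff_prime_int.1 hp)).1 hK Q inferInstance inferInstance
  have hcard := card_inertia_eq_ramificationIdx hp Q
  rw [(ramificationIdx_eq_one_iff_isUnramifiedAt Q).2 hunr] at hcard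
  have hbot := Subgroup.eq_bot_of_card_eq _ hcard
  have hmem : σ.restrictNormal K ∈ Q.inertia Gal(K/ℚ) := by
    intro y
    have : algebraMap (𝓞 K) (𝓞 F) (σ.restrictNormal K • y - y) =
        σ • algebraMap (𝓞 K) (𝓞 F) y - algebraMap (𝓞 K) (𝓞 F) y := by
      apply NumberField.RingOfIntegers.ext
      exact (map_sub (algebraMap K F) _ _).trans
        (congrArg (· - algebraMap K F y) (σ.restrictNormal_commutes K (y : K)))
    change algebraMap (𝓞 K) (𝓞 F) _ ∈ P
    rw [this]
    exact hσ _
  rw [hbot, Subgroup.mem_bot] at hmem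
  rw [← σ.restrictNormal_commutes K x, hmem, AlgEquiv.one_apply]

/-- In a domain, congruent `n`-th roots of an element outside a prime `P` are equal if `n ∉ P`. -/
theorem eq_of_pow_eq_of_sub_mem {R : Type*} [CommRing R] [IsDomain R] (P : Ideal R) [P.IsPrime]
    {n : ℕ} (hn : (n : R) ∉ P) {x y : R} (hx : x ∉ P) (h : y ^ n = x ^ n) (hxy : y - x ∈ P) :
    y = x := by
  by_contra hne
  -- This cofactor of `y - x` in `y ^ n - x ^ n` reduces to `n * x ^ (n - 1)` mod `P`.
  have h0 : (∑ i ∈ Finset.range n, y ^ i * x ^ (n - 1 - i)) = 0 := by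
    have := Commute.geom_sum₂_mul (Commute.all y x) n
    rw [h, sub_self] at this
    exact (mul_eq_zero.1 this).resolve_right (sub_ne_zero.2 hne)
  have hq : Ideal.Quotient.mk P y = Ideal.Quotient.mk P x := Ideal.Quotient.eq.2 hxy
  have h1 : Ideal.Quotient.mk P ((n : R) * x ^ (n - 1)) = 0 := by
    rw [← map_zero (Ideal.Quotient.mk P), ← h0]
    simp only [map_sum, map_mul, map_pow, hq, map_natCast]
    rw [Finset.sum_congr rfl (g := fun _ => Ideal.Quotient.mk P x ^ (n - 1))
      fun i hi => by rw [← pow_add]; congr 1; have := Finset.mem_range.1 hi; omega]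
    simp
  rw [Ideal.Quotient.eq_zero_iff_mem] at h1
  rcases Ideal.IsPrime.mem_or_mem ‹_› h1 with h1 | h1
  · exact hn h1
  · exact hx (Ideal.IsPrime.mem_of_pow_mem ‹_› _ h1)

/-- If `a` generates the `n`-th power of an ideal of a Dedekind domain, then up to `n`-th powers `a`
is a unit at a given prime. -/
theorem exists_pow_mul_eq_pow_mul_notMem {R : Type*} [CommRing R] [IsDedekindDomain R]
    (p : Ideal R) [p.IsPrime] {n : ℕ} {a : R} (ha : a ≠ 0) {I : Ideal R} (h : Ideal.span {a} = I ^ n)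
    (hn : n ≠ 0) : ∃ l j b : R, l ≠ 0 ∧ j ≠ 0 ∧ j ^ n * a = l ^ n * b ∧ b ∉ p := by
  have hI : I ≠ 0 := by
    rintro rfl
    rw [zero_pow hn] at h
    exact ha (Ideal.span_singleton_eq_bot.1 h)
  have hlt : ¬ I ≤ I * p := fun hle => by
    have h1 : I * p = I * ⊤ := by
      rw [Ideal.mul_top]; exact le_antisymm Ideal.mul_le_left hle
    exact Ideal.IsPrime.ne_top ‹_› (mul_left_cancel₀ hI h1)
  -- Write `(l) = I J` with `J ⊄ p`, and `(j) = J I'` with `j ∉ p`. Then `j I = l I'` with `I' ⊄ p`,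
  -- and `b` generates `I' ^ n`.
  obtain ⟨l, hl, hlp⟩ := Set.not_subset.1 hlt
  have hl0 : l ≠ 0 := by rintro rfl; exact hlp (zero_mem _)
  obtain ⟨J, hJ⟩ := Ideal.dvd_iff_le.2 ((Ideal.span_singleton_le_iff_mem I).2 hl)
  have hJp : ¬ J ≤ p := fun hle => hlp <| by
    have : l ∈ I * J := hJ ▸ Ideal.mem_span_singleton_self l
    exact (Ideal.mul_mono le_rfl hle : I * J ≤ I * p) this
  obtain ⟨j, hj, hjp⟩ := Set.not_subset.1 hJp
  have hj0 : j ≠ 0 := by rintro rfl; exact hjp (zero_mem _)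
  obtain ⟨I', hI'⟩ := Ideal.dvd_iff_le.2 ((Ideal.span_singleton_le_iff_mem J).2 hj)
  have hlI : Ideal.span {j} * I = Ideal.span {l} * I' := by
    rw [hI', hJ]; ring
  have hpow : Ideal.span {j ^ n * a} = Ideal.span {l ^ n} * I' ^ n := by
    rw [← Ideal.span_singleton_mul_span_singleton, ← Ideal.span_singleton_pow,
      ← Ideal.span_singleton_pow, h, ← mul_pow, hlI, mul_pow]
  obtain ⟨b, hb⟩ : l ^ n ∣ j ^ n * a := by
    rw [← Ideal.mem_span_singleton]
    have : j ^ n * a ∈ Ideal.span {l ^ n} * I' ^ n := hpow ▸ Ideal.mem_span_singleton_self _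
    exact Ideal.mul_le_left this
  refine ⟨l, j, b, hl0, hj0, hb, fun hbp => hjp ?_⟩
  have hbI : Ideal.span {b} = I' ^ n := by
    rw [hb, ← Ideal.span_singleton_mul_span_singleton] at hpow
    refine mul_left_cancel₀ ?_ hpow
    simpa using fun h => (hl0 h).elim
  have hle : I' ≤ p := Ideal.IsPrime.le_of_pow_le (n := n)
    (hbI ▸ (Ideal.span_singleton_le_iff_mem p).2 hbp)
  have : j ∈ J * I' := hI' ▸ Ideal.mem_span_singleton_self j
  exact hle (Ideal.mul_le_right this)

/-- An inertia element at `P` fixing `K` fixes the `n`-th roots of generators of `n`-th powers of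
ideals of `K`, if `n ∉ P`. -/
theorem root_fixed_of_mem_inertia {K F : Type*} [Field K] [Field F] [NumberField K]
    [NumberField F] [Algebra K F] (P : Ideal (𝓞 F)) [P.IsPrime] {σ : Gal(F/ℚ)}
    (hσ : σ ∈ P.inertia Gal(F/ℚ)) (hσK : ∀ x : K, σ (algebraMap K F x) = algebraMap K F x)
    {n : ℕ} (hn : (n : 𝓞 F) ∉ P) {a : 𝓞 K} {I : Ideal (𝓞 K)} (ha : a ≠ 0)
    (h : Ideal.span {a} = I ^ n) {u : F} (hu : u ^ n = algebraMap K F a) : σ u = u := by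
  have hn0 : n ≠ 0 := by rintro rfl; simp at hn
  obtain ⟨l, j, b, hl, hj, hab, hb⟩ :=
    exists_pow_mul_eq_pow_mul_notMem (P.under (𝓞 K)) ha h hn0
  have hl' : algebraMap K F l ≠ 0 := by simpa using hl
  have hj' : algebraMap K F j ≠ 0 := by simpa using hj
  have hxn : (u * algebraMap K F j / algebraMap K F l) ^ n = algebraMap K F b := by
    rw [div_pow, mul_pow, hu, div_eq_iff (pow_ne_zero _ hl')]
    have := congrArg (fun z : 𝓞 K => algebraMap K F z) hab
    simp only [map_mul, map_pow] at this
    linear_combination this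
  have hint : IsIntegral ℤ (u * algebraMap K F j / algebraMap K F l) := by
    refine IsIntegral.of_pow (Nat.pos_of_ne_zero hn0) ?_
    rw [hxn]
    exact (NumberField.RingOfIntegers.isIntegral_coe b).map (algebraMap K F).toIntAlgHom
  let x : 𝓞 F := ⟨_, hint⟩
  have hxb : x ^ n = algebraMap (𝓞 K) (𝓞 F) b := NumberField.RingOfIntegers.ext hxn
  have hxP : x ∉ P := fun hx => hb <| by
    change algebraMap (𝓞 K) (𝓞 F) b ∈ P
    rw [← hxb]
    exact Ideal.pow_mem_of_mem _ hx _ (Nat.pos_of_ne_zero hn0)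
  have hpow : (σ • x) ^ n = x ^ n := by
    rw [← smul_pow', hxb]
    exact NumberField.RingOfIntegers.ext (hσK b)
  have hfix := congrArg (fun z : 𝓞 F => (z : F)) (eq_of_pow_eq_of_sub_mem P hn hxP hpow (hσ x))
  have hfix' : σ (u * algebraMap K F j / algebraMap K F l) =
    u * algebraMap K F j / algebraMap K F l := hfix
  rw [map_div₀, map_mul, hσK, hσK] at hfix'
  field_simp at hfix'
  exact hfix'

/-- Unramifiedness descends to subfields. -/
theorem isUnramifiedIn_of_algebra {E F : Type*} [Field E] [Field F] [NumberField E]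
    [NumberField F] [Algebra E F] {p : Ideal ℤ}
    (h : Algebra.IsUnramifiedIn (𝓞 F) p) : Algebra.IsUnramifiedIn (𝓞 E) p := by
  intro P _ hP
  obtain ⟨Q, hQ, hQP⟩ := Ideal.exists_ideal_over_prime_of_isIntegral_of_isDomain (S := 𝓞 F) P
    (by simp [(RingHom.injective_iff_ker_eq_bot _).1 (FaithfulSMul.algebraMap_injective (𝓞 E) (𝓞 F))])
  have : Q.LiesOver P := ⟨hQP.symm⟩
  have : Q.LiesOver p := .trans Q P p
  have := h Q hQ this
  exact Algebra.IsUnramifiedAt.of_liesOver ℤ P Q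

/-! ### The field of ideal roots and its normality -/

/-- The nonzero complex numbers `u` for which `u ^ n` generates the `n`-th power of an ideal
of `𝓞 K`. -/
def idealRoots (K : IntermediateField ℚ ℂ) (n : ℕ) : Set ℂ :=
  {u | u ≠ 0 ∧ ∃ (a : 𝓞 K) (I : Ideal (𝓞 K)), ((a : K) : ℂ) = u ^ n ∧ Ideal.span {a} = I ^ n}

/-- The field generated by `K` and the `n`-th roots of generators of `n`-th powers of ideals. -/
noncomputable def idealRootField (K : IntermediateField ℚ ℂ) (n : ℕ) : IntermediateField ℚ ℂ :=
  IntermediateField.adjoin ℚ ((K : Set ℂ) ∪ idealRoots K n)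

theorem le_idealRootField (K : IntermediateField ℚ ℂ) (n : ℕ) : K ≤ idealRootField K n :=
  fun _ hx => IntermediateField.subset_adjoin _ _ (Or.inl hx)

theorem idealRoots_subset_idealRootField (K : IntermediateField ℚ ℂ) (n : ℕ) :
    idealRoots K n ⊆ idealRootField K n :=
  fun _ hx => IntermediateField.subset_adjoin _ _ (Or.inr hx)

theorem fieldOfDefinition_le_idealRootField (K : IntermediateField ℚ ℂ) (n : ℕ) :
    fieldOfDefinition K n ≤ idealRootField K n := by
  refine IntermediateField.adjoin_le_iff.2 ?_
  rintro z ⟨M, ⟨-, u, L, hu, hM, a, ha, hI⟩, i, j, rfl⟩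
  have h1 : u ∈ idealRootField K n :=
    idealRoots_subset_idealRootField K n ⟨hu, a, entryIdeal L, ha, hI⟩
  have h2 : ((L i j : K) : ℂ) ∈ idealRootField K n := le_idealRootField K n (L i j : K).2
  change M i j ∈ idealRootField K n
  rw [hM]
  exact mul_mem (inv_mem h1) h2

theorem map_mem_idealRoots {K : IntermediateField ℚ ℂ} {n : ℕ} (τ : Gal(K/ℚ))
    {F : IntermediateField ℚ ℂ} (ψ : F →ₐ[ℚ] ℂ) (hK : K ≤ F)
    (hψ : ∀ x : K, ψ ⟨x, hK x.2⟩ = τ x) {u : F} (hu : (u : ℂ) ∈ idealRoots K n) :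
    ψ u ∈ idealRoots K n := by
  obtain ⟨hu0, a, I, ha, hI⟩ := hu
  have hu0' : u ≠ 0 := fun h => hu0 (by rw [h]; rfl)
  refine ⟨(map_ne_zero ψ).2 hu0', τ • a, I.map (MulSemiringAction.toRingHom Gal(K/ℚ) (𝓞 K) τ),
    ?_, ?_⟩
  · have h1 : u ^ n = ⟨(a : K), hK (a : K).2⟩ := Subtype.ext ha.symm
    rw [← map_pow, h1, hψ]
    rfl
  · rw [← Ideal.map_pow, ← hI, Ideal.map_span, Set.image_singleton]
    rfl

theorem normal_idealRootField (K : IntermediateField ℚ ℂ) [Normal ℚ K] (n : ℕ)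
    [Algebra.IsAlgebraic ℚ (idealRootField K n)] : Normal ℚ (idealRootField K n) := by
  have hle : ∀ ψ : idealRootField K n →ₐ[ℚ] ℂ, ψ.fieldRange ≤ idealRootField K n := by
    intro ψ
    have hKF := le_idealRootField K n
    let τ : Gal(K/ℚ) := (ψ.comp (IntermediateField.inclusion hKF)).restrictNormal' K
    have hψ : ∀ x : K, ψ ⟨x, hKF x.2⟩ = τ x := fun x =>
      ((ψ.comp (IntermediateField.inclusion hKF)).restrictNormal_commutes K x).symm
    -- The preimage of the field under `ψ` is pushed into `ℂ`, where containment can be tested on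
    -- generators.
    have hcomap : idealRootField K n ≤
        ((idealRootField K n).comap ψ).map (idealRootField K n).val := by
      refine IntermediateField.adjoin_le_iff.2 ?_
      rintro x (hx | hx)
      · refine ⟨⟨x, hKF hx⟩, ?_, rfl⟩
        change ψ ⟨x, hKF hx⟩ ∈ idealRootField K n
        rw [hψ ⟨x, hx⟩]
        exact hKF (τ ⟨x, hx⟩).2
      · refine ⟨⟨x, idealRoots_subset_idealRootField K n hx⟩, ?_, rfl⟩
        exact idealRoots_subset_idealRootField K n (map_mem_idealRoots τ ψ hKF hψ hx)
    rintro _ ⟨x, rfl⟩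
    obtain ⟨y, hy, hyx⟩ := hcomap x.2
    obtain rfl : y = x := Subtype.ext hyx
    exact hy
  have heq : IntermediateField.normalClosure ℚ (idealRootField K n) ℂ = idealRootField K n :=
    le_antisymm (normalClosure_le_iff.2 hle) (IntermediateField.le_normalClosure _)
  have : IsNormalClosure ℚ (idealRootField K n)
      (IntermediateField.normalClosure ℚ (idealRootField K n) ℂ) :=
    Algebra.IsAlgebraic.isNormalClosure_normalClosure fun x => IsAlgClosed.splits _
  have := this.normal
  rwa [heq] at this

/-! ### Finiteness of the field of ideal roots -/

theorem finite_units_of_isTotallyComplex (K : Type*) [Field K] [NumberField K]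
    [Algebra.IsQuadraticExtension ℚ K] [NumberField.IsTotallyComplex K] : Finite (𝓞 K)ˣ := by
  have hrank : NumberField.Units.rank K = 0 := by
    have h1 := NumberField.IsTotallyComplex.finrank K
    have h2 := NumberField.InfinitePlace.card_eq_nrRealPlaces_add_nrComplexPlaces K
    rw [NumberField.IsTotallyComplex.nrRealPlaces_eq_zero] at h2
    rw [Algebra.IsQuadraticExtension.finrank_eq_two] at h1
    rw [NumberField.Units.rank, h2]
    omega
  refine Finite.of_surjective (Subtype.val : NumberField.Units.torsion K → (𝓞 K)ˣ) fun x => ?_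
  obtain ⟨⟨ζ, e⟩, h, -⟩ := NumberField.Units.exist_unique_eq_mul_prod K x
  have : IsEmpty (Fin (NumberField.Units.rank K)) := by rw [hrank]; infer_instance
  exact ⟨ζ, by simpa using h.symm⟩

theorem finite_setOf_pow_eq_unit (K : IntermediateField ℚ ℂ) [Finite (𝓞 K)ˣ] {n : ℕ}
    (hn : n ≠ 0) : {v : ℂ | ∃ ε : (𝓞 K)ˣ, v ^ n = (((ε : 𝓞 K) : K) : ℂ)}.Finite := by
  have : {v : ℂ | ∃ ε : (𝓞 K)ˣ, v ^ n = (((ε : 𝓞 K) : K) : ℂ)} =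
      ⋃ ε : (𝓞 K)ˣ, {v : ℂ | v ^ n = (((ε : 𝓞 K) : K) : ℂ)} := by
    ext v; simp
  rw [this]
  refine Set.finite_iUnion fun ε => ?_
  refine (Polynomial.nthRoots n (((ε : 𝓞 K) : K) : ℂ)).toFinset.finite_toSet.subset fun v hv => ?_
  simpa [Polynomial.mem_nthRoots (Nat.pos_of_ne_zero hn)] using hv

/-- Two elements of `idealRoots K n` with ideals in the same class differ by a factor from `K` and
an `n`-th root of a unit. -/
theorem exists_eq_mul_of_mk0_eq (K : IntermediateField ℚ ℂ) [NumberField K] {n : ℕ}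
    {u w : ℂ} (hw : w ≠ 0) {a b : 𝓞 K} {I J : nonZeroDivisors (Ideal (𝓞 K))}
    (ha : ((a : K) : ℂ) = u ^ n) (hI : Ideal.span {a} = (I : Ideal (𝓞 K)) ^ n)
    (hb : ((b : K) : ℂ) = w ^ n) (hJ : Ideal.span {b} = (J : Ideal (𝓞 K)) ^ n)
    (hIJ : ClassGroup.mk0 I = ClassGroup.mk0 J) :
    ∃ (c : K) (v : ℂ) (ε : (𝓞 K)ˣ), v ^ n = (((ε : 𝓞 K) : K) : ℂ) ∧ u = c * v * w := by
  obtain ⟨x, y, hx, hy, hxy⟩ := ClassGroup.mk0_eq_mk0_iff.1 hIJ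
  -- Both sides are the `n`-th power of `x I = y J`.
  have hspan : Ideal.span {y ^ n * b} = Ideal.span {x ^ n * a} := by
    simp only [← Ideal.span_singleton_mul_span_singleton, ← Ideal.span_singleton_pow, hI, hJ,
      ← mul_pow, hxy]
  obtain ⟨ε, hε⟩ := Ideal.span_singleton_eq_span_singleton.1 hspan
  have hx' : ((x : K) : ℂ) ≠ 0 := by simpa using hx
  have hy' : ((y : K) : ℂ) ≠ 0 := by simpa using hy
  refine ⟨(y : K) / x, u * (x : K) / ((y : K) * w), ε, ?_, ?_⟩
  · have := congrArg (fun z : 𝓞 K => ((z : K) : ℂ)) hε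
    simp only [map_mul, map_pow, MulMemClass.coe_mul, SubmonoidClass.coe_pow] at this
    rw [div_pow, mul_pow, mul_pow, ← ha, ← hb, div_eq_iff]
    · linear_combination -this
    · rw [hb]; positivity
  · push_cast
    field_simp

theorem finiteDimensional_idealRootField (K : IntermediateField ℚ ℂ) [NumberField K]
    [Finite (𝓞 K)ˣ] {n : ℕ} (hn : n ≠ 0) : FiniteDimensional ℚ (idealRootField K n) := by
  classical
  let V : Set ℂ := {v : ℂ | ∃ ε : (𝓞 K)ˣ, v ^ n = (((ε : 𝓞 K) : K) : ℂ)}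
  let R : ClassGroup (𝓞 K) → ℂ → Prop := fun c w => w ≠ 0 ∧
    ∃ (b : 𝓞 K) (J : nonZeroDivisors (Ideal (𝓞 K))), ((b : K) : ℂ) = w ^ n ∧
      Ideal.span {b} = (J : Ideal (𝓞 K)) ^ n ∧ ClassGroup.mk0 J = c
  -- One root per ideal class; the value 1 at classes without a root is only a harmless algebraic
  -- number.
  let r : ClassGroup (𝓞 K) → ℂ := fun c => if h : ∃ w, R c w then h.choose else 1
  let S : Set ℂ := V ∪ Set.range r
  have hVfin : V.Finite := finite_setOf_pow_eq_unit K hn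
  have hSfin : S.Finite := hVfin.union (Set.finite_range r)
  have halg : ∀ w : ℂ, (∃ b : 𝓞 K, ((b : K) : ℂ) = w ^ n) → IsIntegral ℚ w := by
    rintro w ⟨b, hb⟩
    refine IsIntegral.of_pow (Nat.pos_of_ne_zero hn) ?_
    rw [← hb]
    exact (Algebra.IsIntegral.isIntegral (R := ℚ) (b : K)).map K.val
  have hSint : ∀ s ∈ S, IsIntegral ℚ s := by
    rintro s (⟨ε, hs⟩ | ⟨c, rfl⟩)
    · exact halg s ⟨ε, hs.symm⟩
    · by_cases h : ∃ w, R c w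
      · obtain ⟨-, b, J, hb, -⟩ := h.choose_spec
        simp only [r, dif_pos h]
        exact halg _ ⟨b, hb⟩
      · simp only [r, dif_neg h]
        exact isIntegral_one
  have := hSfin.to_subtype
  have : FiniteDimensional ℚ (IntermediateField.adjoin ℚ S) :=
    IntermediateField.finiteDimensional_adjoin hSint
  have hle : idealRootField K n ≤ K ⊔ IntermediateField.adjoin ℚ S := by
    have hS : S ⊆ (K ⊔ IntermediateField.adjoin ℚ S : IntermediateField ℚ ℂ) :=
      fun s hs => (le_sup_right : _ ≤ K ⊔ IntermediateField.adjoin ℚ S)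
        (IntermediateField.subset_adjoin _ _ hs)
    have hK : K ≤ K ⊔ IntermediateField.adjoin ℚ S := le_sup_left
    refine IntermediateField.adjoin_le_iff.2 (Set.union_subset hK ?_)
    rintro u ⟨hu, a, I, ha, hI⟩
    have ha0 : a ≠ 0 := by
      rintro rfl
      exact pow_ne_zero n hu (by rw [← ha]; simp)
    have hI0 : I ∈ nonZeroDivisors (Ideal (𝓞 K)) := by
      refine mem_nonZeroDivisors_of_ne_zero ?_
      rintro rfl
      rw [zero_pow hn] at hI
      exact ha0 (Ideal.span_singleton_eq_bot.1 hI)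
    have hex : ∃ w, R (ClassGroup.mk0 ⟨I, hI0⟩) w := ⟨u, hu, a, ⟨I, hI0⟩, ha, hI, rfl⟩
    have hr : r (ClassGroup.mk0 ⟨I, hI0⟩) = hex.choose := dif_pos hex
    obtain ⟨hw, b, J, hb, hJ, hJI⟩ := hex.choose_spec
    obtain ⟨c, v, ε, hv, huv⟩ :=
      exists_eq_mul_of_mk0_eq K hw (I := ⟨I, hI0⟩) ha hI hb hJ hJI.symm
    rw [huv]
    exact mul_mem (mul_mem (hK c.2) (hS (Or.inl ⟨ε, hv⟩))) (hS (Or.inr ⟨_, hr⟩))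
  have : FiniteDimensional ℚ (K ⊔ IntermediateField.adjoin ℚ S : IntermediateField ℚ ℂ) :=
    IntermediateField.finiteDimensional_sup _ _
  exact Module.Finite.of_injective (IntermediateField.inclusion hle).toLinearMap
    (IntermediateField.inclusion_injective hle)

/-! ### Ramification in the field of ideal roots -/

theorem isUnramifiedIn_idealRootField (K : IntermediateField ℚ ℂ) [NumberField K] [Normal ℚ K]
    {n p : ℕ} [NumberField (idealRootField K n)] (hp : p.Prime)
    (hpn : ¬ p ∣ n) (hpd : ¬ (p : ℤ) ∣ NumberField.discr K) :
    Algebra.IsUnramifiedIn (𝓞 (idealRootField K n)) (Ideal.span {(p : ℤ)}) := by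
  have hKF := le_idealRootField K n
  have := normal_idealRootField K n
  have : IsGalois ℚ (idealRootField K n) := {}
  have : IsGalois ℚ K := {}
  let : Algebra K (idealRootField K n) := (IntermediateField.inclusion hKF).toAlgebra
  intro P _ hP
  have hnP : (n : 𝓞 (idealRootField K n)) ∉ P := by
    intro h
    have h1 : (n : ℤ) ∈ P.under ℤ := by
      change algebraMap ℤ _ (n : ℤ) ∈ P
      simpa using h
    rw [← hP.over, Ideal.mem_span_singleton] at h1
    exact hpn (Int.natCast_dvd_natCast.1 h1)
  have hbot : P.inertia Gal(idealRootField K n/ℚ) = ⊥ := by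
    refine (Subgroup.eq_bot_iff_forall _).2 fun σ hσ => ?_
    have hσK := algebraMap_fixed_of_mem_inertia (K := K) hp hpd P hσ
    -- Since `σ` fixes every generator, the fixed field of `⟨σ⟩` is everything.
    have hfix : idealRootField K n ≤
        (IntermediateField.fixedField (Subgroup.zpowers σ)).map (idealRootField K n).val := by
      have key : ∀ x : idealRootField K n, σ x = x →
          x ∈ IntermediateField.fixedField (Subgroup.zpowers σ) := by
        rintro x hx ⟨g, hg⟩
        have : Subgroup.zpowers σ ≤ MulAction.stabilizer Gal(idealRootField K n/ℚ) x := by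
          rw [Subgroup.zpowers_le]; exact hx
        exact this hg
      refine IntermediateField.adjoin_le_iff.2 ?_
      rintro x (hx | hx)
      · exact ⟨⟨x, hKF hx⟩, key _ (hσK ⟨x, hx⟩), rfl⟩
      · refine ⟨⟨x, idealRoots_subset_idealRootField K n hx⟩, key _ ?_, rfl⟩
        obtain ⟨hx0, a, I, ha, hI⟩ := hx
        have ha0 : a ≠ 0 := by
          rintro rfl
          exact pow_ne_zero n hx0 (by rw [← ha]; simp)
        exact root_fixed_of_mem_inertia P hσ hσK hnP ha0 hI (Subtype.ext ha.symm)
    ext x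
    obtain ⟨y, hy, hyx⟩ := hfix x.2
    obtain rfl : y = x := Subtype.ext hyx
    exact congrArg Subtype.val (hy ⟨σ, Subgroup.mem_zpowers σ⟩)
  rw [← ramificationIdx_eq_one_iff_isUnramifiedAt, ← card_inertia_eq_ramificationIdx hp P, hbot]
  simp

theorem theorem4 (K : IntermediateField ℚ ℂ) [NumberField K] [Algebra.IsQuadraticExtension ℚ K]
    [NumberField.IsTotallyComplex K] (n : ℕ) (hn : 1 ≤ n) :
    NumberField (fieldOfDefinition K n) ∧
      ∀ p : ℕ, p.Prime → ¬ (p : ℤ) ∣ n * NumberField.discr K →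
        Algebra.IsUnramifiedIn (𝓞 (fieldOfDefinition K n)) (Ideal.span {(p : ℤ)}) := by
  have := finite_units_of_isTotallyComplex K
  have := finiteDimensional_idealRootField K (n := n) (by omega)
  have hle := fieldOfDefinition_le_idealRootField K n
  have hF : NumberField (idealRootField K n) := {}
  have : FiniteDimensional ℚ (fieldOfDefinition K n) :=
    Module.Finite.of_injective (IntermediateField.inclusion hle).toLinearMap
      (IntermediateField.inclusion_injective hle)
  have hE : NumberField (fieldOfDefinition K n) := {}
  refine ⟨hE, fun p hp hpd => ?_⟩
  let : Algebra (fieldOfDefinition K n) (idealRootField K n) :=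
    (IntermediateField.inclusion hle).toAlgebra
  refine isUnramifiedIn_of_algebra (F := idealRootField K n) ?_
  exact isUnramifiedIn_idealRootField K hp
    (fun h => hpd (Dvd.dvd.mul_right (Int.natCast_dvd_natCast.2 h) _))
    (fun h => hpd (Dvd.dvd.mul_left h _))
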